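/- Let $\Theta\subset\mathbb R^m$ be a nonempty convex polyhedron (a finite intersection of closed half-spaces), let $f\colon\mathbb R^n\to\mathbb R$, $g\colon\mathbb R^n\to\mathbb R^m$, put $\Gamma:=\{x\in\mathbb R^n\mid g(x)\in\Theta\}$, and consider the problem $$\text{minimize } f(x)\quad\text{subject to } g(x)\in\Theta. \tag{P}$$ **Notation.** All spaces carry the Euclidean inner product and norm. For $\varphi\colon\mathbb R^d\to(-\infty,\infty]$ and $x$ with $\varphi(x)<\infty$ the regular subdifferential is $$\widehat\partial\varphi(x)=\Big\{v\;\Big|\;\liminf_{u\to x}\frac{\varphi(u)-\varphi(x)-\langle v,u-x\rangle}{\|u-x\|}\ge 0\Big\},$$ and the limiting subdifferential $\partial\varphi(x)$ is the set of all limits of sequences $v_k\in\widehat\partial\varphi(x_k)$ with $x_k\to x$ and $\varphi(x_k)\to\varphi(x)$; both are empty where $\varphi=\infty$. For a set $\Omega$ with indicator function $\delta_\Omega$ ($0$ on $\Omega$, $\infty$ elsewhere) put $\widehat N_\Omega:=\widehat\partial\delta_\Omega$ and $N_\Omega:=\partial\delta_\Omega$. The tangent cone $T_\Omega(x)$ consists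 of all $w$ for which there are $t_k\downarrow 0$ and $w_k\to w$ with $x+t_kw_k\in\Omega$ for all $k$, and the critical cone is $K_\Omega(x,v):=T_\Omega(x)\cap\{v\}^\perp$. For $f$ continuously differentiable around $\bar x$, the combined second-order subdifferential of $f$ at $\bar x$ is $$\breve\partial^2 f(\bar x)(w):=\big\{z\in\mathbb R^n\;\big|\;(z,-w)\in\widehat N_{\operatorname{gph}\partial f}(\bar x,\nabla f(\bar x))\big\},\qquad \operatorname{gph}\partial f=\{(x,v)\mid v\in\partial f(x)\}.$$ **Theorem.** Let $\bar x$ be a local minimizer of (P). Assume that around $\bar x$ the function $f$ is of class $\mathcal C^{1,1}$ (differentiable with Lipschitz continuous gradient) and $g$ is $\mathcal C^2$-smooth, and that the metric subregularity constraint qualification (MSCQ) holds at $\bar x$: there are a neighborhood $U$ of $\bar x$ and $\kappa>0$ with $$\operatorname{dist}(x;\Gamma)\le\kappa\,\operatorname{dist}(g(x);\Theta)\quad\text{for all }x\in U.$$ Then $\bar x$ satisfies the first-order optimality condition $$\nabla f(\bar x)+\nabla g(\bar x)^*\bar y=0\quad\text{for some }\bar y\in N_\Theta(g(\bar x)). \tag{1}$$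 If in addition the vector $\bar y$ in (1) is unique, then: (a) $\langle z,w\rangle+\langle w,\nabla^2\langle\bar y,g\rangle(\bar x)w\rangle\ge 0$ for all $w\in-K_\Gamma(\bar x,-\nabla f(\bar x))$ and all $z\in\breve\partial^2f(\bar x)(w)$; (b) if moreover $\bar x$ is a strong local minimizer of (P) with modulus $\sigma>0$, i.e. $f(x)\ge f(\bar x)+\frac{\sigma}{2}\|x-\bar x\|^2$ for all $x\in\Gamma$ near $\bar x$, then $$\langle z,w\rangle+\langle w,\nabla^2\langle\bar y,g\rangle(\bar x)w\rangle\ge\sigma\|w\|^2$$ for all $w\in-K_\Gamma(\bar x,-\nabla f(\bar x))$ and all $z\in\breve\partial^2f(\bar x)(w)$. -/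

import Mathlib

open Filter Topology

noncomputable section

namespace VarAnalysis

variable {E F : Type*}

/-! ### First-order generalized differentiation

Extended-real-valued functions `φ : E → (-∞, ∞]` are modelled as functions into `EReal`; the value
`-∞` is never taken by the functions considered below. -/

/-- The indicator function `δ_Ω`, equal to `0` on `Ω` and to `∞` outside of `Ω`. -/
def indicatorFun (Ω : Set E) (x : E) : EReal :=
  open Classical in if x ∈ Ω then 0 else ⊤

/-- The (Fréchet) regular subdifferential: `v ∈ ∂̂φ(x)` iff `φ(x) < ∞` and
`liminf_{u → x} (φ(u) - φ(x) - ⟨v, u - x⟩) / ‖u - x‖ ≥ 0`. -/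
def regularSubdiff [NormedAddCommGroup E] [InnerProductSpace ℝ E]
    (φ : E → EReal) (x : E) : Set E :=
  {v | φ x < ⊤ ∧
    0 ≤ liminf (fun u => (φ u - φ x - ((inner ℝ v (u - x) : ℝ) : EReal)) / ((‖u - x‖ : ℝ) : EReal))
      (𝓝[≠] x)}

/-- The (Mordukhovich) limiting subdifferential: the outer limit of the regular subdifferentials
along `x_k → x` with `φ(x_k) → φ(x)`. -/
def limitingSubdiff [NormedAddCommGroup E] [InnerProductSpace ℝ E]
    (φ : E → EReal) (x : E) : Set E :=
  {v | φ x < ⊤ ∧ ∃ (xs vs : ℕ → E),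
    Tendsto xs atTop (𝓝 x) ∧ Tendsto (fun k => φ (xs k)) atTop (𝓝 (φ x)) ∧
    Tendsto vs atTop (𝓝 v) ∧ ∀ k, vs k ∈ regularSubdiff φ (xs k)}

/-- The regular normal cone `N̂_Ω(x) = ∂̂δ_Ω(x)` (empty if `x ∉ Ω`). -/
def regularNormalCone [NormedAddCommGroup E] [InnerProductSpace ℝ E]
    (Ω : Set E) (x : E) : Set E :=
  regularSubdiff (indicatorFun Ω) x

/-- The limiting normal cone `N_Ω(x) = ∂δ_Ω(x)` (empty if `x ∉ Ω`). -/
def normalCone [NormedAddCommGroup E] [InnerProductSpace ℝ E]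
    (Ω : Set E) (x : E) : Set E :=
  limitingSubdiff (indicatorFun Ω) x

/-- The (Bouligand-Severi) tangent (contingent) cone `T_Ω(x)`. -/
def tangentCone [NormedAddCommGroup E] [InnerProductSpace ℝ E]
    (Ω : Set E) (x : E) : Set E :=
  {w | ∃ (t : ℕ → ℝ) (ws : ℕ → E),
    (∀ k, 0 < t k) ∧ Tendsto t atTop (𝓝 0) ∧ Tendsto ws atTop (𝓝 w) ∧
    ∀ k, x + t k • ws k ∈ Ω}

/-- The critical cone `K_Ω(x, v) = T_Ω(x) ∩ {v}^⊥`. -/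
def criticalCone [NormedAddCommGroup E] [InnerProductSpace ℝ E]
    (Ω : Set E) (x v : E) : Set E :=
  tangentCone Ω x ∩ {w | inner ℝ v w = 0}

/-! ### Coderivatives and the combined second-order subdifferential -/

/-- The graph of a set-valued mapping, in the product with its Euclidean (`ℓ²`) structure. -/
def gph [NormedAddCommGroup E] [NormedAddCommGroup F] (M : E → Set F) : Set (WithLp 2 (E × F)) :=
  {p | p.snd ∈ M p.fst}

/-- The regular coderivative: `v ∈ D̂*M(x, y)(u)` iff `(v, -u) ∈ N̂_{gph M}(x, y)`. -/
def regularCoderiv [NormedAddCommGroup E] [InnerProductSpace ℝ E]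
    [NormedAddCommGroup F] [InnerProductSpace ℝ F]
    (M : E → Set F) (x : E) (y : F) (u : F) : Set E :=
  {v | WithLp.toLp 2 (v, -u) ∈ regularNormalCone (gph M) (WithLp.toLp 2 (x, y))}

/-- The combined second-order subdifferential `(D̂*∂φ)(x, v)(u)`. -/
def combinedSecondSubdiff [NormedAddCommGroup E] [InnerProductSpace ℝ E]
    (φ : E → EReal) (x v u : E) : Set E :=
  regularCoderiv (limitingSubdiff φ) x v u

/-- The combined second-order subdifferential of a real-valued function `f` which is continuously
differentiable around `x`; the subgradient is then `∇f(x)`. -/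
def combinedSecondSubdiffReal [NormedAddCommGroup E] [InnerProductSpace ℝ E] [CompleteSpace E]
    (f : E → ℝ) (x u : E) : Set E :=
  combinedSecondSubdiff (fun x' => (f x' : EReal)) x (gradient f x) u

/-! ### The constrained problem: minimize `f(x)` subject to `g(x) ∈ Θ` -/

/-- `f` is of class `C^{1,1}` around `x`: it is differentiable with a Lipschitz continuous gradient
on a neighborhood of `x`. -/
def IsC11Around [NormedAddCommGroup E] [InnerProductSpace ℝ E] [CompleteSpace E]
    (f : E → ℝ) (x : E) : Prop :=
  ∃ U ∈ 𝓝 x, (∀ u ∈ U, DifferentiableAt ℝ f u) ∧ ∃ L, LipschitzOnWith L (gradient f) U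

/-- A convex polyhedron: a finite intersection of closed half-spaces. -/
def IsConvexPolyhedron [NormedAddCommGroup F] [InnerProductSpace ℝ F] (Θ : Set F) : Prop :=
  ∃ (p : ℕ) (a : Fin p → F) (b : Fin p → ℝ), Θ = {y | ∀ i, inner ℝ (a i) y ≤ b i}

/-- The feasible set `Γ = {x | g(x) ∈ Θ}`. -/
def feasibleSet (g : E → F) (Θ : Set F) : Set E :=
  {x | g x ∈ Θ}

/-- The metric subregularity constraint qualification at a feasible point `x`:
`dist(u; Γ) ≤ κ dist(g(u); Θ)` for all `u` near `x`, with some `κ > 0`. -/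
def MSCQ [NormedAddCommGroup E] [NormedAddCommGroup F] (g : E → F) (Θ : Set F) (x : E) : Prop :=
  ∃ κ > (0 : ℝ), ∃ U ∈ 𝓝 x, ∀ u ∈ U,
    Metric.infDist u (feasibleSet g Θ) ≤ κ * Metric.infDist (g u) Θ

/-- `x` is a local minimizer of `f` subject to the constraint set `Γ`. -/
def IsLocalMinimizer [NormedAddCommGroup E] (f : E → ℝ) (Γ : Set E) (x : E) : Prop :=
  x ∈ Γ ∧ IsLocalMinOn f Γ x

/-- `x` is a strong local minimizer of `f` with modulus `σ` subject to the constraint set `Γ`. -/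
def IsStrongLocalMinimizer [NormedAddCommGroup E] (f : E → ℝ) (Γ : Set E) (σ : ℝ) (x : E) : Prop :=
  x ∈ Γ ∧ ∃ U ∈ 𝓝 x, ∀ u ∈ U, u ∈ Γ → f x + σ / 2 * ‖u - x‖ ^ 2 ≤ f u

/-- The vectors `y ∈ N_Θ(g(x))` satisfying the first-order optimality condition
`∇f(x) + ∇g(x)^* y = 0`. -/
def multipliers [NormedAddCommGroup E] [InnerProductSpace ℝ E] [CompleteSpace E]
    [NormedAddCommGroup F] [InnerProductSpace ℝ F] [CompleteSpace F]
    (f : E → ℝ) (g : E → F) (Θ : Set F) (x : E) : Set F :=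
  {y | y ∈ normalCone Θ (g x) ∧ gradient f x + ContinuousLinearMap.adjoint (fderiv ℝ g x) y = 0}

/-- The Hessian `∇²⟨y, g⟩(x)` of the scalarized mapping, as a linear operator. -/
def scalarizedHessian [NormedAddCommGroup E] [InnerProductSpace ℝ E] [CompleteSpace E]
    [NormedAddCommGroup F] [InnerProductSpace ℝ F]
    (g : E → F) (y : F) (x : E) : E →L[ℝ] E :=
  fderiv ℝ (gradient (fun x' => (inner ℝ y (g x') : ℝ))) x

end VarAnalysis

end

/-!
Let `Γ = {x | g x ∈ Θ}` and let `p` be a second-order tangent vector to `Γ` at `x` in the critical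
direction `-w`. Comparing `f` along the parabolas `x - t w + (t² / 2) p' ∈ Γ` with its second-order
upper estimate provided by `z ∈ ∂̆²f(x)(w)` yields `σ ‖w‖² ≤ ⟨z, w⟩ + ⟨∇f(x), p⟩`. By MSCQ, `p` is
second-order tangent to `Γ` as soon as `∇²g(x)(w, w) + ∇g(x) p` is second-order tangent to `Θ`,
which for a polyhedron is a finite system of linear inequalities in `p`. The affine Farkas lemma
converts the resulting implication between linear inequalities into a multiplier `y` with
`σ ‖w‖² ≤ ⟨z, w⟩ + ⟨w, ∇²⟨y, g⟩(x) w⟩`; taking `w = 0` gives the first-order condition.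
-/

namespace VarAnalysis

section Farkas

variable {ι 𝕜 V : Type*} [Field 𝕜] [LinearOrder 𝕜] [IsStrictOrderedRing 𝕜] [AddCommGroup V]
  [Module 𝕜 V]

theorem mem_hull_of_forall_nonpos {s : Finset ι} {A : ι → Module.Dual 𝕜 V} {c : Module.Dual 𝕜 V}
    (h : ∀ x, (∀ i ∈ s, A i x ≤ 0) → c x ≤ 0) : c ∈ PointedCone.hull 𝕜 (A '' s) := by
  classical
  induction s using Finset.induction_on generalizing A c with
  | empty =>
    have hc : c = 0 := LinearMap.ext fun x =>
      le_antisymm (h x (by simp)) (by simpa using h (-x) (by simp))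
    exact hc ▸ zero_mem _
  | insert j s _ ih =>
    have hmono : PointedCone.hull 𝕜 (A '' s) ≤ PointedCone.hull 𝕜 (A '' insert j s) :=
      Submodule.span_mono (Set.image_mono (Set.subset_insert j s))
    rw [Finset.coe_insert]
    by_cases hs : ∀ x, (∀ i ∈ s, A i x ≤ 0) → c x ≤ 0
    · exact hmono (ih hs)
    push Not at hs
    obtain ⟨x₁, hx₁, hcx₁⟩ := hs
    have hjx₁ : 0 < A j x₁ := by
      by_contra! hjx₁
      exact hcx₁.not_ge (h x₁ (Finset.forall_mem_insert _ _ _ |>.2 ⟨hjx₁, hx₁⟩))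
    -- Subtracting multiples of `A j` makes all functionals vanish on `x₀`, reducing to `s`.
    obtain ⟨x₀, hjx₀, hx₀, hcx₀⟩ : ∃ x₀, A j x₀ = 1 ∧ (∀ i ∈ s, A i x₀ ≤ 0) ∧ 0 ≤ c x₀ := by
      refine ⟨(A j x₁)⁻¹ • x₁, by simp [hjx₁.ne'], fun i hi => ?_, ?_⟩
      · simpa using mul_nonpos_of_nonneg_of_nonpos (inv_nonneg.2 hjx₁.le) (hx₁ i hi)
      · simpa using mul_nonneg (inv_nonneg.2 hjx₁.le) hcx₁.le
    have hreduced : c - c x₀ • A j ∈ PointedCone.hull 𝕜 ((fun i => A i - A i x₀ • A j) '' s) := by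
      refine ih fun x hx => ?_
      have hx' := h (x - A j x • x₀) (Finset.forall_mem_insert _ _ _ |>.2
        ⟨by simp [hjx₀], fun i hi => by simpa [mul_comm] using hx i hi⟩)
      simpa [mul_comm] using hx'
    have hj : A j ∈ PointedCone.hull 𝕜 (A '' insert j s) :=
      PointedCone.subset_hull (Set.mem_image_of_mem A (Set.mem_insert j _))
    have hle : PointedCone.hull 𝕜 ((fun i => A i - A i x₀ • A j) '' s) ≤
        PointedCone.hull 𝕜 (A '' insert j s) := by
      refine Submodule.span_le.2 (Set.image_subset_iff.2 fun i hi => ?_)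
      have hi' := PointedCone.subset_hull (R := 𝕜)
        (Set.mem_image_of_mem A (Set.mem_insert_of_mem j hi))
      simpa [sub_eq_add_neg] using
        add_mem hi' (PointedCone.smul_mem _ (neg_nonneg.2 (hx₀ i hi)) hj)
    simpa using add_mem (hle hreduced) (PointedCone.smul_mem _ hcx₀ hj)

theorem exists_nonneg_combination_of_forall_le {s : Finset ι} {A : ι → Module.Dual 𝕜 V}
    {c : Module.Dual 𝕜 V} {r : ι → 𝕜} {d : 𝕜} (h : ∀ x, (∀ i ∈ s, A i x ≤ r i) → c x ≤ d)
    (h₀ : ∀ x, (∀ i ∈ s, A i x ≤ 0) → c x ≤ 0) :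
    ∃ l : ι → 𝕜, (∀ i, 0 ≤ l i) ∧ ∑ i ∈ s, l i • A i = c ∧ ∑ i ∈ s, l i * r i ≤ d := by
  have hhom : ∀ q : V × 𝕜, 0 ≤ q.2 → (∀ i ∈ s, A i q.1 ≤ r i * q.2) → c q.1 ≤ d * q.2 := by
    rintro ⟨x, τ⟩ hτ hx
    rcases hτ.eq_or_lt with rfl | hτ
    · simpa using h₀ x (by simpa using hx)
    · have := h (τ⁻¹ • x) fun i hi => by
        simpa [inv_mul_le_iff₀ hτ, mul_comm] using hx i hi
      simpa [inv_mul_le_iff₀ hτ, mul_comm] using this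
  let A' : Option ι → Module.Dual 𝕜 (V × 𝕜) := fun o => o.elim (-LinearMap.snd 𝕜 V 𝕜)
    fun i => A i ∘ₗ LinearMap.fst 𝕜 V 𝕜 - r i • LinearMap.snd 𝕜 V 𝕜
  have hmem : c ∘ₗ LinearMap.fst 𝕜 V 𝕜 - d • LinearMap.snd 𝕜 V 𝕜 ∈
      PointedCone.hull 𝕜 (A' '' (Finset.insertNone s)) := by
    refine mem_hull_of_forall_nonpos fun q hq => ?_
    rw [Finset.forall_mem_insertNone] at hq
    simpa using hhom q (by simpa [A'] using hq.1) (by simpa [A'] using hq.2)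
  obtain ⟨l, hl₀, hl⟩ : ∃ l : Option ι → 𝕜, (∀ o, 0 ≤ l o) ∧ ∑ o ∈ s.insertNone, l o • A' o =
      c ∘ₗ LinearMap.fst 𝕜 V 𝕜 - d • LinearMap.snd 𝕜 V 𝕜 := by
    obtain ⟨l, hl⟩ := (Submodule.mem_span_image_finset_iff_exists_fun' _).1 hmem
    exact ⟨fun o => l o, fun o => (l o).2, hl⟩
  rw [Finset.sum_insertNone] at hl
  refine ⟨fun i => l (some i), fun i => hl₀ _, LinearMap.ext fun x => ?_, ?_⟩
  · simpa [A'] using LinearMap.congr_fun hl (x, 0)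
  · have hd : l none + ∑ i ∈ s, l (some i) * r i = d := by
      simpa [A', ← neg_add_rev, add_comm] using LinearMap.congr_fun hl (0, 1)
    exact (le_add_of_nonneg_left (hl₀ _)).trans_eq hd

end Farkas

section LinearProgramming

variable {ι E F : Type*} [NormedAddCommGroup E] [InnerProductSpace ℝ E]
  [NormedAddCommGroup F] [InnerProductSpace ℝ F]

theorem exists_nonneg_sum_smul_of_forall_le_inner {s : Finset ι} {a : ι → F} {A : E →L[ℝ] F}
    {c : E} {β : F} {d : ℝ} (h : ∀ p, (∀ i ∈ s, inner ℝ (a i) (β + A p) ≤ 0) → d ≤ inner ℝ c p)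
    (h₀ : ∀ p, (∀ i ∈ s, inner ℝ (a i) (A p) ≤ 0) → 0 ≤ inner ℝ c p) :
    ∃ l : ι → ℝ, (∀ i, 0 ≤ l i) ∧ (∀ v, inner ℝ (∑ i ∈ s, l i • a i) (A v) = -inner ℝ c v) ∧
      d ≤ inner ℝ (∑ i ∈ s, l i • a i) β := by
  obtain ⟨l, hl, hc, hd⟩ := exists_nonneg_combination_of_forall_le (s := s)
    (A := fun i => ((innerSL ℝ (a i)).comp A).toLinearMap) (c := (-innerSL ℝ c).toLinearMap)
    (r := fun i => -inner ℝ (a i) β) (d := -d)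
    (fun p hp => neg_le_neg (h p fun i hi => by
      simpa [inner_add_right, ← le_neg_iff_add_nonpos_left] using hp i hi))
    (fun p hp => neg_nonpos.2 (h₀ p hp))
  refine ⟨l, hl, fun v => ?_, ?_⟩
  · simpa [sum_inner, real_inner_smul_left] using LinearMap.congr_fun hc v
  · simpa [sum_inner, real_inner_smul_left] using hd

end LinearProgramming

section Subdifferentials

variable {E : Type*} [NormedAddCommGroup E] [InnerProductSpace ℝ E]

theorem mem_regularSubdiff_iff {φ : E → EReal} {x v : E} {c : ℝ} (hc : φ x = c) :
    v ∈ regularSubdiff φ x ↔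
      ∀ ε > 0, ∀ᶠ u in 𝓝 x, ((c + inner ℝ v (u - x) - ε * ‖u - x‖ : ℝ) : EReal) ≤ φ u := by
  have hquot : ∀ ε : ℝ, ∀ u, u ≠ x → (((-ε : ℝ) : EReal) ≤
      (φ u - φ x - ((inner ℝ v (u - x) : ℝ) : EReal)) / ((‖u - x‖ : ℝ) : EReal) ↔
      ((c + inner ℝ v (u - x) - ε * ‖u - x‖ : ℝ) : EReal) ≤ φ u) := fun ε u hu => by
    have hpos : 0 < ‖u - x‖ := norm_pos_iff.2 (sub_ne_zero.2 hu)
    rw [EReal.le_div_iff_mul_le (EReal.coe_pos.2 hpos) (EReal.coe_ne_top _), hc, ← EReal.coe_mul]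
    induction φ u with
    | bot => simp [-EReal.coe_mul, -EReal.coe_add, -EReal.coe_sub]
    | top => simp [-EReal.coe_mul, -EReal.coe_add, -EReal.coe_sub]
    | coe r =>
      norm_cast
      constructor <;> intro h <;> linarith
  have hreal : (∀ y < (0 : EReal), ∀ᶠ u in 𝓝[≠] x, y ≤
      (φ u - φ x - ((inner ℝ v (u - x) : ℝ) : EReal)) / ((‖u - x‖ : ℝ) : EReal)) ↔
      ∀ ε > (0 : ℝ), ∀ᶠ u in 𝓝[≠] x, ((-ε : ℝ) : EReal) ≤
        (φ u - φ x - ((inner ℝ v (u - x) : ℝ) : EReal)) / ((‖u - x‖ : ℝ) : EReal) := by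
    refine ⟨fun h ε hε => h _ (by exact_mod_cast neg_lt_zero.2 hε), fun h y hy => ?_⟩
    obtain ⟨r, hyr, hr⟩ := EReal.lt_iff_exists_real_btwn.1 hy
    filter_upwards [h (-r) (by simpa using hr)] with u hu
    exact hyr.le.trans (by simpa using hu)
  rw [regularSubdiff, Set.mem_ofPred_eq, le_liminf_iff', hreal, hc,
    and_iff_right (EReal.coe_lt_top c)]
  refine forall₂_congr fun ε _ => ?_
  rw [eventually_nhdsWithin_iff]
  refine eventually_congr (Eventually.of_forall fun u => ?_)
  rcases eq_or_ne u x with rfl | hu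
  · simp [hc]
  · rw [← hc]
    simpa [hu] using hquot ε u hu

theorem mem_regularNormalCone_iff {Ω : Set E} {x v : E} (hx : x ∈ Ω) :
    v ∈ regularNormalCone Ω x ↔
      ∀ ε > 0, ∀ᶠ u in 𝓝 x, u ∈ Ω → inner ℝ v (u - x) ≤ ε * ‖u - x‖ := by
  rw [regularNormalCone, mem_regularSubdiff_iff (c := 0) (by simp [indicatorFun, hx])]
  refine forall₂_congr fun ε _ => eventually_congr (Eventually.of_forall fun u => ?_)
  by_cases hu : u ∈ Ω
  · simp only [indicatorFun, hu, if_true, zero_add, forall_const, ← EReal.coe_zero,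
      EReal.coe_le_coe_iff, sub_nonpos]
  · simp [indicatorFun, hu]

theorem regularSubdiff_subset_limitingSubdiff (φ : E → EReal) (x : E) :
    regularSubdiff φ x ⊆ limitingSubdiff φ x := fun v hv =>
  ⟨hv.1, fun _ => x, fun _ => v, tendsto_const_nhds, tendsto_const_nhds, tendsto_const_nhds,
    fun _ => hv⟩

theorem mem_normalCone_of_forall_inner_le {Θ : Set E} {x y : E} (hx : x ∈ Θ)
    (hy : ∀ u ∈ Θ, inner ℝ y u ≤ inner ℝ y x) : y ∈ normalCone Θ x := by
  refine regularSubdiff_subset_limitingSubdiff _ _ ((mem_regularNormalCone_iff hx).2 fun ε hε =>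
    Eventually.of_forall fun u hu => ?_)
  rw [inner_sub_right]
  exact (sub_nonpos.2 (hy u hu)).trans (by positivity)

variable [CompleteSpace E] {f : E → ℝ} {x w z : E}

theorem gradient_mem_limitingSubdiff (hf : DifferentiableAt ℝ f x) :
    gradient f x ∈ limitingSubdiff (fun u => (f u : EReal)) x := by
  refine regularSubdiff_subset_limitingSubdiff _ _
    ((mem_regularSubdiff_iff (φ := fun u => (f u : EReal)) rfl).2 fun ε hε => ?_)
  filter_upwards [(hasGradientAt_iff_isLittleO.1 hf.hasGradientAt).def hε] with u hu
  rw [EReal.coe_le_coe_iff]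
  linarith [(abs_le.1 hu).1]

theorem zero_mem_combinedSecondSubdiffReal (hf : DifferentiableAt ℝ f x) :
    (0 : E) ∈ combinedSecondSubdiffReal f x 0 := by
  have hgph : WithLp.toLp 2 (x, gradient f x) ∈ gph (limitingSubdiff fun u => (f u : EReal)) :=
    gradient_mem_limitingSubdiff hf
  change WithLp.toLp 2 (0, -0) ∈ regularNormalCone _ (WithLp.toLp 2 (x, gradient f x))
  rw [neg_zero, mem_regularNormalCone_iff hgph]
  intro ε hε
  filter_upwards with u _
  rw [Prod.mk_zero_zero, WithLp.toLp_zero, inner_zero_left]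
  positivity

theorem eventually_inner_le_of_mem_combinedSecondSubdiffReal (hf : IsC11Around f x)
    (hz : z ∈ combinedSecondSubdiffReal f x w) {ε : ℝ} (hε : 0 < ε) :
    ∀ᶠ u in 𝓝 x, inner ℝ z (u - x) - inner ℝ w (gradient f u - gradient f x) ≤ ε * ‖u - x‖ := by
  obtain ⟨U, hU, hd, L, hL⟩ := hf
  set γ : E → WithLp 2 (E × E) := fun u => WithLp.toLp 2 (u, gradient f u)
  have hgph : ∀ u ∈ U, γ u ∈ gph (limitingSubdiff fun u => (f u : EReal)) := fun u hu =>
    gradient_mem_limitingSubdiff (hd u hu)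
  obtain ⟨K, hK⟩ : ∃ K, LipschitzOnWith K γ U := ⟨_,
    (WithLp.prod_lipschitzWith_toLp 2 E E).comp_lipschitzOnWith
      (LipschitzWith.id.lipschitzOnWith.prodMk hL)⟩
  have hγ := (hK.continuousOn.continuousAt hU).eventually
    ((mem_regularNormalCone_iff (hgph x (mem_of_mem_nhds hU))).1 hz (ε / (K + 1)) (by positivity))
  filter_upwards [hγ, hU] with u hu huU
  have hinner : inner ℝ (WithLp.toLp 2 (z, -w)) (γ u - γ x) =
      inner ℝ z (u - x) - inner ℝ w (gradient f u - gradient f x) := by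
    rw [WithLp.prod_inner_apply, sub_eq_add_neg (inner ℝ z (u - x)), ← inner_neg_left]
    rfl
  calc _ ≤ ε / (K + 1) * ‖γ u - γ x‖ := hinner ▸ hu (hgph u huU)
    _ ≤ ε / (K + 1) * ((K + 1) * ‖u - x‖) := by
        have := hK.norm_sub_le huU (mem_of_mem_nhds hU)
        gcongr
        exact this.trans (by gcongr; simp)
    _ = ε * ‖u - x‖ := by field_simp

end Subdifferentials

section Parabolas

variable {E : Type*} [NormedAddCommGroup E] [NormedSpace ℝ E]

theorem add_smul_add_sq_div_two_smul (x v p : E) (t : ℝ) :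
    x + t • v + (t ^ 2 / 2) • p = x + t • (v + (t / 2) • p) := by
  module

theorem tendsto_add_smul_nhds (x d : E) :
    Tendsto (fun q : ℝ × E => x + q.1 • q.2) (𝓝[≥] 0 ×ˢ 𝓝 d) (𝓝 x) := by
  have : Continuous fun q : ℝ × E => x + q.1 • q.2 := by fun_prop
  have := this.tendsto (0, d)
  rw [nhds_prod_eq, zero_smul, add_zero] at this
  exact this.mono_left (prod_mono_left _ nhdsWithin_le_nhds)

theorem tendsto_add_half_smul_nhds (v p : E) :
    Tendsto (fun q : ℝ × E => (q.1, v + (q.1 / 2) • q.2)) (𝓝[>] 0 ×ˢ 𝓝 p)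
      (𝓝[≥] 0 ×ˢ 𝓝 v) := by
  have : Continuous fun q : ℝ × E => v + (q.1 / 2) • q.2 := by fun_prop
  have := this.tendsto (0, p)
  rw [nhds_prod_eq, zero_div, zero_smul, add_zero] at this
  exact (tendsto_fst.mono_right (nhdsWithin_mono _ Set.Ioi_subset_Ici_self)).prodMk
    (this.mono_left (prod_mono_left _ nhdsWithin_le_nhds))

theorem hasDerivAt_parabola (x v p : E) (t : ℝ) :
    HasDerivAt (fun t : ℝ => x + t • v + (t ^ 2 / 2) • p) (v + t • p) t := by
  convert! (((hasDerivAt_id t).smul_const v).const_add x).add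
    ((((hasDerivAt_id t).pow 2).div_const 2).smul_const p) using 2 <;> simp

theorem isLittleO_sub_parabola {G D : ℝ → E} {D' : E} (hG : ∀ᶠ t in 𝓝 0, HasDerivAt G (D t) t)
    (hD : HasDerivAt D D' 0) :
    (fun t => G t - (G 0 + t • D 0 + (t ^ 2 / 2) • D')) =o[𝓝 0] fun t : ℝ => t ^ 2 := by
  obtain ⟨δ, hδ, hball⟩ := Metric.eventually_nhds_iff_ball.1 hG
  have h := (convex_ball (0 : ℝ) δ).isLittleO_pow_succ_real (n := 1) (Metric.mem_ball_self hδ)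
    (fun t ht => ((hball t ht).sub (hasDerivAt_parabola (G 0) (D 0) D' t)).hasDerivWithinAt)
    (by simpa [sub_sub] using (hasDerivAt_iff_isLittleO.1 hD).mono nhdsWithin_le_nhds)
  simpa [Metric.isOpen_ball.nhdsWithin_eq (Metric.mem_ball_self hδ)] using h

end Parabolas

section SecondOrderExpansion

variable {E : Type*} [NormedAddCommGroup E] [InnerProductSpace ℝ E] [CompleteSpace E]
  {f : E → ℝ} {x w z : E}

theorem le_of_inner_gradient_sub_le {d : E} {t C : ℝ} (ht : 0 ≤ t)
    (hf : ∀ s ∈ Set.Icc 0 t, DifferentiableAt ℝ f (x + s • d))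
    (hC : ∀ s ∈ Set.Icc 0 t, inner ℝ (gradient f (x + s • d) - gradient f x) d ≤ s * C) :
    f (x + t • d) ≤ f x + t * inner ℝ (gradient f x) d + t ^ 2 / 2 * C := by
  have hφ : ∀ s ∈ Set.Icc 0 t, HasDerivAt (fun s : ℝ => f (x + s • d))
      (inner ℝ (gradient f (x + s • d)) d) s := fun s hs => by
    have hray : HasDerivAt (fun s : ℝ => x + s • d) d s := by
      simpa using ((hasDerivAt_id s).smul_const d).const_add x
    exact (hf s hs).hasGradientAt.hasFDerivAt.comp_hasDerivAt s hray
  have hB : ∀ s, HasDerivAt (fun s : ℝ => f x + s * inner ℝ (gradient f x) d + s ^ 2 / 2 * C)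
      (inner ℝ (gradient f x) d + s * C) s := fun s => by
    convert! (((hasDerivAt_id s).mul_const (inner ℝ (gradient f x) d)).const_add (f x)).add
      ((((hasDerivAt_id s).pow 2).div_const 2).mul_const C) using 1
    simp
  refine image_le_of_deriv_right_le_deriv_boundary
    (fun s hs => (hφ s hs).continuousAt.continuousWithinAt)
    (fun s hs => (hφ s (Set.Ico_subset_Icc_self hs)).hasDerivWithinAt) (by simp)
    (fun s _ => (hB s).continuousAt.continuousWithinAt) (fun s _ => (hB s).hasDerivWithinAt)
    (fun s hs => ?_) (Set.right_mem_Icc.2 ht)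
  have := hC s (Set.Ico_subset_Icc_self hs)
  rw [inner_sub_left] at this
  linarith

theorem eventually_inner_gradient_sub_le (hf : IsC11Around f x)
    (hz : z ∈ combinedSecondSubdiffReal f x w) {ε : ℝ} (hε : 0 < ε) :
    ∀ᶠ q : ℝ × E in 𝓝[≥] 0 ×ˢ 𝓝 (-w),
      inner ℝ (gradient f (x + q.1 • q.2) - gradient f x) q.2 ≤ q.1 * (inner ℝ z w + ε) := by
  obtain ⟨U, hU, -, L, hL⟩ := id hf
  set ε' := ε / (‖w‖ + 1)
  have hε' : ε' * ‖w‖ < ε := by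
    rw [div_mul_eq_mul_div, div_lt_iff₀ (by positivity)]
    linarith
  have hrate : ∀ᶠ d in 𝓝 (-w),
      L * ‖w + d‖ * ‖d‖ + ε' * ‖d‖ - inner ℝ z d < inner ℝ z w + ε := by
    have : Continuous fun d => L * ‖w + d‖ * ‖d‖ + ε' * ‖d‖ - inner ℝ z d := by fun_prop
    refine (this.tendsto (-w)).eventually_lt_const ?_
    simpa [add_comm (inner ℝ z w)] using hε'
  have hray := tendsto_add_smul_nhds x (-w)
  filter_upwards [hray.eventually (eventually_inner_le_of_mem_combinedSecondSubdiffReal hf hz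
    (ε := ε') (by positivity)), hray hU, tendsto_fst self_mem_nhdsWithin,
    tendsto_snd.eventually hrate]
  rintro ⟨s, d⟩ hz' hU' (hs : 0 ≤ s) hd
  set Δ := gradient f (x + s • d) - gradient f x
  have hΔ : ‖Δ‖ ≤ L * (s * ‖d‖) := by
    simpa [norm_smul, abs_of_nonneg hs] using hL.norm_sub_le hU' (mem_of_mem_nhds hU)
  simp only [add_sub_cancel_left, inner_smul_right, norm_smul, Real.norm_of_nonneg hs] at hz'
  calc inner ℝ Δ d = inner ℝ (w + d) Δ - inner ℝ w Δ := by
        rw [inner_add_left, add_sub_cancel_left, real_inner_comm]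
    _ ≤ ‖w + d‖ * (L * (s * ‖d‖)) + (ε' * (s * ‖d‖) - s * inner ℝ z d) := by
        have := (real_inner_le_norm (w + d) Δ).trans
          (mul_le_mul_of_nonneg_left hΔ (norm_nonneg _))
        linarith
    _ = s * (L * ‖w + d‖ * ‖d‖ + ε' * ‖d‖ - inner ℝ z d) := by ring
    _ ≤ s * (inner ℝ z w + ε) := by gcongr

theorem eventually_le_of_mem_combinedSecondSubdiffReal (hf : IsC11Around f x)
    (hz : z ∈ combinedSecondSubdiffReal f x w) {ε : ℝ} (hε : 0 < ε) :
    ∀ᶠ q : ℝ × E in 𝓝[≥] 0 ×ˢ 𝓝 (-w), f (x + q.1 • q.2) ≤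
      f x + q.1 * inner ℝ (gradient f x) q.2 + q.1 ^ 2 / 2 * (inner ℝ z w + ε) := by
  obtain ⟨U, hU, hd, -⟩ := id hf
  obtain ⟨T, hT, V, hV, hTV⟩ := eventually_prod_iff.1
    (((tendsto_add_smul_nhds x (-w)).eventually hU).and (eventually_inner_gradient_sub_le hf hz hε))
  obtain ⟨δ, hδ, hδT⟩ := mem_nhdsGE_iff_exists_Ico_subset.1 hT
  filter_upwards [prod_mem_prod (Ico_mem_nhdsGE (Set.mem_Ioi.1 hδ)) hV]
  rintro ⟨t, d⟩ ⟨ht, hdV⟩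
  have hs : ∀ s ∈ Set.Icc 0 t, T s := fun s hs => hδT ⟨hs.1, hs.2.trans_lt ht.2⟩
  exact le_of_inner_gradient_sub_le ht.1 (fun s hst => hd _ (hTV (hs s hst) hdV).1)
    fun s hst => (hTV (hs s hst) hdV).2

end SecondOrderExpansion

section Taylor

variable {E F : Type*} [NormedAddCommGroup E] [NormedSpace ℝ E]
  [NormedAddCommGroup F] [NormedSpace ℝ F] {g : E → F} {x : E}

theorem hasFDerivAt_fderiv_of_contDiffAt (hg : ContDiffAt ℝ 2 g x) :
    HasFDerivAt (fderiv ℝ g) (fderiv ℝ (fderiv ℝ g) x) x :=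
  ((hg.fderiv_right (m := 1) (by norm_num)).differentiableAt one_ne_zero).hasFDerivAt

theorem eventually_differentiableAt_of_contDiffAt (hg : ContDiffAt ℝ 2 g x) :
    ∀ᶠ u in 𝓝 x, DifferentiableAt ℝ g u :=
  (hg.eventually (by simp)).mono fun _ hu => hu.differentiableAt two_ne_zero

theorem isLittleO_comp_parabola (hg : ContDiffAt ℝ 2 g x) (v p : E) :
    (fun t : ℝ => g (x + t • v + (t ^ 2 / 2) • p) - (g x + t • fderiv ℝ g x v +
      (t ^ 2 / 2) • (fderiv ℝ (fderiv ℝ g) x v v + fderiv ℝ g x p))) =o[𝓝 0]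
      fun t : ℝ => t ^ 2 := by
  set c : ℝ → E := fun t => x + t • v + (t ^ 2 / 2) • p
  have hc : ∀ t, HasDerivAt c (v + t • p) t := hasDerivAt_parabola x v p
  have hc₀ : c 0 = x := by simp [c]
  have hG : ∀ᶠ t in 𝓝 0, HasDerivAt (g ∘ c) (fderiv ℝ g (c t) (v + t • p)) t := by
    have hct : Tendsto c (𝓝 0) (𝓝 x) := hc₀ ▸ (hc 0).continuousAt.tendsto
    filter_upwards [hct.eventually (eventually_differentiableAt_of_contDiffAt hg)] with t ht
    exact ht.hasFDerivAt.comp_hasDerivAt t (hc t)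
  have hD : HasDerivAt (fun t => fderiv ℝ g (c t)) (fderiv ℝ (fderiv ℝ g) x v) 0 := by
    simpa [Function.comp_def] using
      (hasFDerivAt_fderiv_of_contDiffAt hg).comp_hasDerivAt_of_eq 0 (hc 0) hc₀.symm
  simpa [hc₀] using isLittleO_sub_parabola hG
    (hD.clm_apply (((hasDerivAt_id (0 : ℝ)).smul_const p).const_add v))

end Taylor

section SecondOrderTangents

variable {E F : Type*} [NormedAddCommGroup E] [NormedSpace ℝ E]
  [NormedAddCommGroup F] [NormedSpace ℝ F]

/-- The (outer) second-order tangent set `T²_Ω(x; v)`: the limits `p` of sequences `p_k` with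
`x + t_k v + (t_k² / 2) p_k ∈ Ω` for some `t_k ↓ 0`. The sequences are encoded by the frequent
occurrence of `(t, p') → (0⁺, p)`. -/
def secondOrderTangentSet (Ω : Set E) (x v : E) : Set E :=
  {p | ∃ᶠ q : ℝ × E in 𝓝[>] 0 ×ˢ 𝓝 p, x + q.1 • v + (q.1 ^ 2 / 2) • q.2 ∈ Ω}

theorem mem_secondOrderTangentSet_of_eventually {Ω : Set E} {x v p : E}
    (h : ∀ᶠ t : ℝ in 𝓝[>] 0, x + t • v + (t ^ 2 / 2) • p ∈ Ω) : p ∈ secondOrderTangentSet Ω x v :=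
  Tendsto.frequently (f := fun t : ℝ => (t, p)) (tendsto_id.prodMk tendsto_const_nhds) h.frequently

theorem mem_secondOrderTangentSet_iff_infDist {Ω : Set E} (hΩ : Ω.Nonempty) {x v p : E} :
    p ∈ secondOrderTangentSet Ω x v ↔ ∀ ε > 0, ∃ᶠ t : ℝ in 𝓝[>] 0,
      Metric.infDist (x + t • v + (t ^ 2 / 2) • p) Ω < t ^ 2 / 2 * ε := by
  have hball : ∀ t > 0, ∀ ε, Metric.infDist (x + t • v + (t ^ 2 / 2) • p) Ω < t ^ 2 / 2 * ε ↔
      ∃ p' ∈ Metric.ball p ε, x + t • v + (t ^ 2 / 2) • p' ∈ Ω := fun t ht ε => by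
    have ht2 : 0 < t ^ 2 / 2 := by positivity
    have hdist : ∀ p', dist (x + t • v + (t ^ 2 / 2) • p) (x + t • v + (t ^ 2 / 2) • p') <
        t ^ 2 / 2 * ε ↔ p' ∈ Metric.ball p ε := fun p' => by
      rw [dist_add_left, dist_smul₀, Real.norm_of_nonneg ht2.le, mul_lt_mul_iff_right₀ ht2,
        Metric.mem_ball']
    rw [Metric.infDist_lt_iff hΩ]
    refine ⟨fun ⟨u, hu, hlt⟩ => ?_, fun ⟨p', hp', hmem⟩ => ⟨_, hmem, (hdist p').2 hp'⟩⟩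
    have hup : x + t • v + (t ^ 2 / 2) • ((t ^ 2 / 2)⁻¹ • (u - (x + t • v))) = u := by
      rw [smul_inv_smul₀ ht2.ne', add_sub_cancel]
    exact ⟨_, (hdist _).1 (hup.symm ▸ hlt), hup.symm ▸ hu⟩
  rw [secondOrderTangentSet, Set.mem_ofPred_eq,
    ((nhdsGT_basis (0 : ℝ)).prod Metric.nhds_basis_ball).frequently_iff]
  simp only [(nhdsGT_basis (0 : ℝ)).frequently_iff, Prod.forall, Prod.exists]
  constructor
  · intro h ε hε δ hδ
    obtain ⟨t, p', ⟨ht, hp'⟩, hmem⟩ := h δ ε ⟨hδ, hε⟩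
    exact ⟨t, ht, (hball t ht.1 ε).2 ⟨p', hp', hmem⟩⟩
  · rintro h δ ε ⟨hδ, hε⟩
    obtain ⟨t, ht, hlt⟩ := h ε hε δ hδ
    obtain ⟨p', hp', hmem⟩ := (hball t ht.1 ε).1 hlt
    exact ⟨t, p', ⟨ht, hp'⟩, hmem⟩

theorem MSCQ.mem_secondOrderTangentSet_feasibleSet {g : E → F} {Θ : Set F} {x v p : E}
    (hM : MSCQ g Θ x) (hx : x ∈ feasibleSet g Θ) (hg : ContDiffAt ℝ 2 g x)
    (hp : fderiv ℝ (fderiv ℝ g) x v v + fderiv ℝ g x p ∈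
      secondOrderTangentSet Θ (g x) (fderiv ℝ g x v)) :
    p ∈ secondOrderTangentSet (feasibleSet g Θ) x v := by
  obtain ⟨κ, hκ, U, hU, hM⟩ := hM
  rw [mem_secondOrderTangentSet_iff_infDist (Ω := Θ) ⟨g x, hx⟩] at hp
  refine (mem_secondOrderTangentSet_iff_infDist ⟨x, hx⟩).2 fun ε hε => ?_
  have hcurve : Tendsto (fun t : ℝ => x + t • v + (t ^ 2 / 2) • p) (𝓝[>] 0) (𝓝 x) := by
    simpa using (hasDerivAt_parabola x v p 0).continuousAt.tendsto.mono_left nhdsWithin_le_nhds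
  have hTaylor := (isLittleO_comp_parabola hg v p).def (c := ε / (4 * κ)) (by positivity)
  refine ((hp (ε / (2 * κ)) (by positivity)).and_eventually
    ((hcurve.eventually hU).and (nhdsWithin_le_nhds hTaylor))).mono ?_
  rintro t ⟨hmodel, htU, htaylor⟩
  rw [← dist_eq_norm, Real.norm_of_nonneg (sq_nonneg t)] at htaylor
  calc Metric.infDist (x + t • v + (t ^ 2 / 2) • p) (feasibleSet g Θ)
      ≤ κ * Metric.infDist (g (x + t • v + (t ^ 2 / 2) • p)) Θ := hM _ htU
    _ < κ * (t ^ 2 / 2 * (ε / (2 * κ)) + ε / (4 * κ) * t ^ 2) := by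
        gcongr
        exact Metric.infDist_le_infDist_add_dist.trans_lt (add_lt_add_of_lt_of_le hmodel htaylor)
    _ = t ^ 2 / 2 * ε := by field_simp; ring

end SecondOrderTangents

section Polyhedra

variable {ι F : Type*} [NormedAddCommGroup F] [InnerProductSpace ℝ F]

/-- The intersection of the closed half-spaces `{y | ⟨a_i, y⟩ ≤ b_i}`. -/
def polyhedron (a : ι → F) (b : ι → ℝ) : Set F :=
  {y | ∀ i, inner ℝ (a i) y ≤ b i}

theorem eventually_parabola_le {α β γ δ : ℝ} (h : α ≤ β) (h₁ : α = β → γ ≤ 0)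
    (h₂ : α = β → γ = 0 → δ ≤ 0) : ∀ᶠ t in 𝓝[>] 0, α + t * γ + t ^ 2 / 2 * δ ≤ β := by
  rcases h.lt_or_eq with hlt | heq
  · have hcont : Continuous fun t => α + t * γ + t ^ 2 / 2 * δ := by fun_prop
    filter_upwards [nhdsWithin_le_nhds ((hcont.tendsto 0).eventually_lt_const
      (u := β) (by simpa using hlt))] with t ht using ht.le
  rcases (h₁ heq).lt_or_eq with hlt | hγ
  · have hcont : Continuous fun t => γ + t / 2 * δ := by fun_prop
    filter_upwards [nhdsWithin_le_nhds ((hcont.tendsto 0).eventually_lt_const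
      (u := 0) (by simpa using hlt)), self_mem_nhdsWithin] with t ht hpos
    linarith [mul_neg_of_pos_of_neg hpos ht]
  · filter_upwards with t
    have := mul_nonpos_of_nonneg_of_nonpos (by positivity : 0 ≤ t ^ 2 / 2) (h₂ heq hγ)
    rw [hγ, mul_zero, heq]
    linarith

variable {a : ι → F} {b : ι → ℝ} {q : F}

theorem mem_secondOrderTangentSet_polyhedron [Finite ι] {v p : F} (hq : q ∈ polyhedron a b)
    (hv : ∀ i, inner ℝ (a i) q = b i → inner ℝ (a i) v ≤ 0)
    (hp : ∀ i, inner ℝ (a i) q = b i → inner ℝ (a i) v = 0 → inner ℝ (a i) p ≤ 0) :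
    p ∈ secondOrderTangentSet (polyhedron a b) q v := by
  refine mem_secondOrderTangentSet_of_eventually (eventually_all.2 fun i => ?_)
  simpa only [inner_add_right, inner_smul_right] using
    eventually_parabola_le (hq i) (hv i) (hp i)

theorem sum_smul_mem_normalCone_polyhedron {s : Finset ι} {l : ι → ℝ} (hq : q ∈ polyhedron a b)
    (hs : ∀ i ∈ s, inner ℝ (a i) q = b i) (hl : ∀ i, 0 ≤ l i) :
    ∑ i ∈ s, l i • a i ∈ normalCone (polyhedron a b) q := by
  refine mem_normalCone_of_forall_inner_le hq fun u hu => ?_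
  simp only [sum_inner, real_inner_smul_left]
  gcongr with i hi
  · exact hl i
  · exact (hu i).trans_eq (hs i hi).symm

end Polyhedra

section Hessian

variable {E F : Type*} [NormedAddCommGroup E] [InnerProductSpace ℝ E] [CompleteSpace E]
  [NormedAddCommGroup F] [InnerProductSpace ℝ F] {g : E → F} {x : E}

theorem inner_scalarizedHessian_apply (hg : ContDiffAt ℝ 2 g x) (y : F) (w : E) :
    inner ℝ w (scalarizedHessian g y x w) = inner ℝ y (fderiv ℝ (fderiv ℝ g) x w w) := by
  have hgrad : gradient (fun u => (inner ℝ y (g u) : ℝ)) =ᶠ[𝓝 x]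
      fun u => (InnerProductSpace.toDual ℝ E).symm ((innerSL ℝ y).comp (fderiv ℝ g u)) := by
    filter_upwards [eventually_differentiableAt_of_contDiffAt hg] with u hu
    exact congrArg _ ((innerSL ℝ y).hasFDerivAt.comp u hu.hasFDerivAt).fderiv
  let T : (E →L[ℝ] F) →L[ℝ] E := LinearMap.mkContinuous
    { toFun := fun A => (InnerProductSpace.toDual ℝ E).symm ((innerSL ℝ y).comp A)
      map_add' := fun A B => by simp
      map_smul' := fun r A => by simp } ‖y‖
    fun A => by simpa using (innerSL ℝ y).opNorm_comp_le A
  have hT : HasFDerivAt (gradient fun u => (inner ℝ y (g u) : ℝ))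
      (T.comp (fderiv ℝ (fderiv ℝ g) x)) x :=
    (T.hasFDerivAt.comp x (hasFDerivAt_fderiv_of_contDiffAt hg)).congr_of_eventuallyEq hgrad
  rw [scalarizedHessian, hT.fderiv, real_inner_comm]
  simp [T]

end Hessian

section OptimalityConditions

theorem IsLocalMinimizer.isStrongLocalMinimizer_zero {E : Type*} [NormedAddCommGroup E]
    {f : E → ℝ} {Γ : Set E} {x : E} (hx : IsLocalMinimizer f Γ x) :
    IsStrongLocalMinimizer f Γ 0 x :=
  ⟨hx.1, _, eventually_nhdsWithin_iff.1 hx.2, fun u hu huΓ => by simpa using hu huΓ⟩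

theorem inner_fderiv_nonpos_of_mem_tangentCone {E F : Type*} [NormedAddCommGroup E]
    [InnerProductSpace ℝ E] [NormedAddCommGroup F] [InnerProductSpace ℝ F] {g : E → F}
    {Θ : Set F} {x v : E} (hg : DifferentiableAt ℝ g x)
    (hv : v ∈ tangentCone (feasibleSet g Θ) x) {a : F}
    (ha : ∀ q ∈ Θ, inner ℝ a q ≤ inner ℝ a (g x)) : inner ℝ a (fderiv ℝ g x v) ≤ 0 := by
  obtain ⟨t, ws, ht, ht₀, hws, hmem⟩ := hv
  have hlim := hg.hasFDerivAt.hasFDerivWithinAt (s := Set.univ) |>.lim (l := atTop)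
    (c := fun k => (t k)⁻¹) (d := fun k => t k • ws k) (v := v)
    (by simpa using ht₀.smul hws) (by simp) (by simpa [(ht _).ne'] using hws)
  refine le_of_tendsto ((tendsto_const_nhds (x := a)).inner hlim) (Eventually.of_forall fun k => ?_)
  rw [real_inner_smul_right, inner_sub_right]
  exact mul_nonpos_of_nonneg_of_nonpos (inv_nonneg.2 (ht k).le) (sub_nonpos.2 (ha _ (hmem k)))

theorem zero_mem_criticalCone {E : Type*} [NormedAddCommGroup E] [InnerProductSpace ℝ E]
    {Γ : Set E} {x : E} (hx : x ∈ Γ) (y : E) : 0 ∈ criticalCone Γ x y :=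
  ⟨⟨fun k => 1 / (k + 1), fun _ => 0, fun k => by positivity,
    tendsto_one_div_add_atTop_nhds_zero_nat, tendsto_const_nhds, fun k => by simpa using hx⟩,
    inner_zero_right y⟩

variable {ι E F : Type*} [NormedAddCommGroup E] [InnerProductSpace ℝ E] [CompleteSpace E]
  [NormedAddCommGroup F] [InnerProductSpace ℝ F]
  {f : E → ℝ} {g : E → F} {a : ι → F} {b : ι → ℝ} {σ : ℝ} {x w z v p : E}

theorem IsC11Around.differentiableAt (hf : IsC11Around f x) : DifferentiableAt ℝ f x := by
  obtain ⟨U, hU, hd, -⟩ := hf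
  exact hd x (mem_of_mem_nhds hU)

theorem mem_multipliers_iff [CompleteSpace F] {Θ : Set F} {y : F} : y ∈ multipliers f g Θ x ↔
    y ∈ normalCone Θ (g x) ∧ ∀ v, inner ℝ y (fderiv ℝ g x v) = -inner ℝ (gradient f x) v := by
  refine and_congr_right fun _ => ⟨fun h v => ?_, fun h => ext_inner_right ℝ fun v => ?_⟩
  · rw [← ContinuousLinearMap.adjoint_inner_left, eq_neg_iff_add_eq_zero, ← inner_add_left,
      add_comm, h, inner_zero_left]
  · rw [inner_add_left, ContinuousLinearMap.adjoint_inner_left, h v, add_neg_cancel,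
      inner_zero_left]

theorem IsStrongLocalMinimizer.le_inner_add_inner_gradient {Γ : Set E}
    (hx : IsStrongLocalMinimizer f Γ σ x)
    (hf : IsC11Around f x) (hz : z ∈ combinedSecondSubdiffReal f x w)
    (hw : inner ℝ (gradient f x) w = 0) (hp : p ∈ secondOrderTangentSet Γ x (-w)) :
    σ * ‖w‖ ^ 2 ≤ inner ℝ z w + inner ℝ (gradient f x) p := by
  obtain ⟨-, U, hU, hmin⟩ := hx
  have hd := tendsto_add_half_smul_nhds (-w) p
  refine le_of_forall_pos_le_add fun ε hε => ?_
  have hfreq : ∃ᶠ q : ℝ × E in 𝓝[>] 0 ×ˢ 𝓝 p,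
      σ * ‖-w + (q.1 / 2) • q.2‖ ^ 2 ≤ inner ℝ z w + inner ℝ (gradient f x) q.2 + ε := by
    have hupper := hd.eventually (eventually_le_of_mem_combinedSecondSubdiffReal hf hz hε)
    have hU := ((tendsto_add_smul_nhds x (-w)).comp hd).eventually hU
    have hpos : ∀ᶠ q : ℝ × E in 𝓝[>] 0 ×ˢ 𝓝 p, 0 < q.1 := tendsto_fst self_mem_nhdsWithin
    refine (hp.and_eventually (hU.and (hupper.and hpos))).mono ?_
    rintro ⟨t, p'⟩ ⟨hΓ, hqU, hub, ht⟩
    rw [add_smul_add_sq_div_two_smul] at hΓ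
    have hlb := hmin _ hqU hΓ
    have hslope : inner ℝ (gradient f x) (-w + (t / 2) • p') =
        t / 2 * inner ℝ (gradient f x) p' := by
      rw [inner_add_right, inner_neg_right, hw, neg_zero, zero_add, inner_smul_right]
    simp only [Function.comp_apply, add_sub_cancel_left, norm_smul, Real.norm_of_nonneg ht.le,
      hslope] at hlb hub
    refine le_of_mul_le_mul_left ?_ (by positivity : 0 < t ^ 2 / 2)
    linear_combination hlb + hub
  have hlim := le_of_tendsto_of_tendsto_of_frequently
    (((tendsto_snd.comp hd).norm.pow 2).const_mul σ)
    ((((continuous_const.inner continuous_id).tendsto p).comp tendsto_snd).const_add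
      (inner ℝ z w) |>.add_const ε) hfreq
  simpa using hlim

variable [Finite ι]

theorem IsStrongLocalMinimizer.le_inner_add_inner_gradient_of_polyhedron
    (hx : IsStrongLocalMinimizer f (feasibleSet g (polyhedron a b)) σ x) (hf : IsC11Around f x)
    (hg : ContDiffAt ℝ 2 g x) (hM : MSCQ g (polyhedron a b) x)
    (hz : z ∈ combinedSecondSubdiffReal f x w) (hw : inner ℝ (gradient f x) w = 0)
    (hv : ∀ i, inner ℝ (a i) (g x) = b i → inner ℝ (a i) (fderiv ℝ g x (-w)) ≤ 0)
    (hp : ∀ i, inner ℝ (a i) (g x) = b i → inner ℝ (a i) (fderiv ℝ g x (-w)) = 0 →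
      inner ℝ (a i) (fderiv ℝ (fderiv ℝ g) x w w + fderiv ℝ g x p) ≤ 0) :
    σ * ‖w‖ ^ 2 ≤ inner ℝ z w + inner ℝ (gradient f x) p :=
  hx.le_inner_add_inner_gradient hf hz hw (hM.mem_secondOrderTangentSet_feasibleSet hx.1 hg
    (mem_secondOrderTangentSet_polyhedron hx.1 hv (by simpa using hp)))

theorem IsLocalMinimizer.inner_gradient_nonneg
    (hx : IsLocalMinimizer f (feasibleSet g (polyhedron a b)) x) (hf : IsC11Around f x)
    (hg : ContDiffAt ℝ 2 g x) (hM : MSCQ g (polyhedron a b) x)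
    (hp : ∀ i, inner ℝ (a i) (g x) = b i → inner ℝ (a i) (fderiv ℝ g x p) ≤ 0) :
    0 ≤ inner ℝ (gradient f x) p := by
  simpa using hx.isStrongLocalMinimizer_zero.le_inner_add_inner_gradient_of_polyhedron hf hg hM
    (zero_mem_combinedSecondSubdiffReal hf.differentiableAt) (p := p) (by simp) (by simp)
    (by simpa using hp)

theorem IsLocalMinimizer.inner_gradient_nonneg_of_inner_eq_zero
    (hx : IsLocalMinimizer f (feasibleSet g (polyhedron a b)) x) (hf : IsC11Around f x)
    (hg : ContDiffAt ℝ 2 g x) (hM : MSCQ g (polyhedron a b) x)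
    (hfv : inner ℝ (gradient f x) v = 0)
    (hv : ∀ i, inner ℝ (a i) (g x) = b i → inner ℝ (a i) (fderiv ℝ g x v) ≤ 0)
    (hp : ∀ i, inner ℝ (a i) (g x) = b i → inner ℝ (a i) (fderiv ℝ g x v) = 0 →
      inner ℝ (a i) (fderiv ℝ g x p) ≤ 0) :
    0 ≤ inner ℝ (gradient f x) p := by
  have hstep : ∀ᶠ t : ℝ in 𝓝[>] 0, ∀ i, inner ℝ (a i) (g x) = b i →
      inner ℝ (a i) (fderiv ℝ g x (v + t • p)) ≤ 0 := by
    refine eventually_all.2 fun i => eventually_imp_distrib_left.2 fun hi => ?_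
    simpa [inner_add_right, inner_smul_right] using
      eventually_parabola_le (δ := 0) (hv i hi) (hp i hi) fun _ _ => le_rfl
  obtain ⟨t, ht, hpos⟩ := (hstep.and self_mem_nhdsWithin).exists
  have := hx.inner_gradient_nonneg hf hg hM ht
  rw [inner_add_right, hfv, zero_add, inner_smul_right] at this
  exact nonneg_of_mul_nonneg_right this hpos

theorem IsStrongLocalMinimizer.exists_mem_multipliers_of_polyhedron [CompleteSpace F]
    (hx : IsStrongLocalMinimizer f (feasibleSet g (polyhedron a b)) σ x)
    (hx₀ : IsLocalMinimizer f (feasibleSet g (polyhedron a b)) x) (hf : IsC11Around f x)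
    (hg : ContDiffAt ℝ 2 g x) (hM : MSCQ g (polyhedron a b) x)
    (hw : -w ∈ criticalCone (feasibleSet g (polyhedron a b)) x (-gradient f x))
    (hz : z ∈ combinedSecondSubdiffReal f x w) :
    ∃ y ∈ multipliers f g (polyhedron a b) x,
      σ * ‖w‖ ^ 2 ≤ inner ℝ z w + inner ℝ w (scalarizedHessian g y x w) := by
  obtain ⟨hwT, hfw⟩ := hw
  replace hfw : inner ℝ (gradient f x) w = 0 := by simpa using hfw
  have hv : ∀ i, inner ℝ (a i) (g x) = b i → inner ℝ (a i) (fderiv ℝ g x (-w)) ≤ 0 := fun i hi =>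
    inner_fderiv_nonpos_of_mem_tangentCone (hg.differentiableAt two_ne_zero) hwT
      fun q hq => (hq i).trans_eq hi.symm
  set J := {i | inner ℝ (a i) (g x) = b i ∧
    inner ℝ (a i) (fderiv ℝ g x (-w)) = 0}.toFinite.toFinset
  have hJ : ∀ {i}, i ∈ J ↔ inner ℝ (a i) (g x) = b i ∧
      inner ℝ (a i) (fderiv ℝ g x (-w)) = 0 := by simp [J]
  obtain ⟨l, hl, hgrad, hval⟩ := exists_nonneg_sum_smul_of_forall_le_inner (s := J) (a := a)
    (fun p hp => sub_le_iff_le_add'.2 (hx.le_inner_add_inner_gradient_of_polyhedron hf hg hM hz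
      hfw hv fun i hi hiw => hp i (hJ.2 ⟨hi, hiw⟩)))
    (fun p hp => hx₀.inner_gradient_nonneg_of_inner_eq_zero hf hg hM (by simpa using hfw) hv
      fun i hi hiw => hp i (hJ.2 ⟨hi, hiw⟩))
  refine ⟨∑ i ∈ J, l i • a i, mem_multipliers_iff.2
    ⟨sum_smul_mem_normalCone_polyhedron hx.1 (fun i hi => (hJ.1 hi).1) hl, hgrad⟩, ?_⟩
  rw [inner_scalarizedHessian_apply hg]
  exact sub_le_iff_le_add'.1 hval

end OptimalityConditions

end VarAnalysis

theorem theorem7p3_general {E F : Type*} [NormedAddCommGroup E] [InnerProductSpace ℝ E]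
    [CompleteSpace E] [NormedAddCommGroup F] [InnerProductSpace ℝ F] [CompleteSpace F]
    (f : E → ℝ) (g : E → F) (Θ : Set F) (x : E) (hΘ : VarAnalysis.IsConvexPolyhedron Θ)
    (hx : VarAnalysis.IsLocalMinimizer f (VarAnalysis.feasibleSet g Θ) x)
    (hf : VarAnalysis.IsC11Around f x) (hg : ContDiffAt ℝ 2 g x)
    (hMSCQ : VarAnalysis.MSCQ g Θ x) :
    (VarAnalysis.multipliers f g Θ x).Nonempty ∧
    ∀ σ : ℝ, VarAnalysis.IsStrongLocalMinimizer f (VarAnalysis.feasibleSet g Θ) σ x →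
      ∀ w, -w ∈ VarAnalysis.criticalCone (VarAnalysis.feasibleSet g Θ) x (-gradient f x) →
        ∀ z ∈ VarAnalysis.combinedSecondSubdiffReal f x w,
          ∃ y ∈ VarAnalysis.multipliers f g Θ x,
            σ * ‖w‖ ^ 2 ≤
              (inner ℝ z w : ℝ) + inner ℝ w (VarAnalysis.scalarizedHessian g y x w) := by
  obtain ⟨_, a, b, hab⟩ := hΘ
  obtain rfl : Θ = VarAnalysis.polyhedron a b := hab
  refine ⟨?_, fun σ hσ w hw z hz =>
    hσ.exists_mem_multipliers_of_polyhedron hx hf hg hMSCQ hw hz⟩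
  obtain ⟨y, hy, -⟩ := hx.isStrongLocalMinimizer_zero.exists_mem_multipliers_of_polyhedron
    (w := 0) hx hf hg hMSCQ (by simpa using VarAnalysis.zero_mem_criticalCone hx.1 _)
    (VarAnalysis.zero_mem_combinedSecondSubdiffReal hf.differentiableAt)
  exact ⟨y, hy⟩

theorem theorem7p3 {n m : ℕ}
    (f : EuclideanSpace ℝ (Fin n) → ℝ)
    (g : EuclideanSpace ℝ (Fin n) → EuclideanSpace ℝ (Fin m))
    (Θ : Set (EuclideanSpace ℝ (Fin m)))
    (x : EuclideanSpace ℝ (Fin n))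
    (hΘne : Θ.Nonempty) (hΘ : VarAnalysis.IsConvexPolyhedron Θ)
    (hx : VarAnalysis.IsLocalMinimizer f (VarAnalysis.feasibleSet g Θ) x)
    (hf : VarAnalysis.IsC11Around f x)
    (hg : ContDiffAt ℝ 2 g x)
    (hMSCQ : VarAnalysis.MSCQ g Θ x) :
    (VarAnalysis.multipliers f g Θ x).Nonempty ∧
    ∀ y : EuclideanSpace ℝ (Fin m), VarAnalysis.multipliers f g Θ x = {y} →
      (∀ w, -w ∈ VarAnalysis.criticalCone (VarAnalysis.feasibleSet g Θ) x (-gradient f x) →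
        ∀ z ∈ VarAnalysis.combinedSecondSubdiffReal f x w,
          0 ≤ (inner ℝ z w : ℝ) + inner ℝ w (VarAnalysis.scalarizedHessian g y x w)) ∧
      (∀ σ : ℝ, 0 < σ →
        VarAnalysis.IsStrongLocalMinimizer f (VarAnalysis.feasibleSet g Θ) σ x →
        ∀ w, -w ∈ VarAnalysis.criticalCone (VarAnalysis.feasibleSet g Θ) x (-gradient f x) →
          ∀ z ∈ VarAnalysis.combinedSecondSubdiffReal f x w,
            σ * ‖w‖ ^ 2 ≤
              (inner ℝ z w : ℝ) + inner ℝ w (VarAnalysis.scalarizedHessian g y x w)) := by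
  obtain ⟨hne, hsecond⟩ := theorem7p3_general f g Θ x hΘ hx hf hg hMSCQ
  refine ⟨hne, fun y hy => ⟨fun w hw z hz => ?_, fun σ _ hσ w hw z hz => ?_⟩⟩
  · obtain ⟨_, rfl, h⟩ := hy ▸ hsecond 0 hx.isStrongLocalMinimizer_zero w hw z hz
    simpa using h
  · obtain ⟨_, rfl, h⟩ := hy ▸ hsecond σ hσ w hw z hz
    exact h
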